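/- Work on the interval $(0,1)$ with real-valued functions. For $\theta\in L^2(0,1)$ let $\mathcal F\theta(\xi)=(2\pi)^{-1/2}\int_0^1 e^{-i\xi x}\theta(x)\,dx$ ($\xi\in\mathbb R$) and $\|\theta\|_{H^{-2}}=\|(1+|\xi|^2)^{-1}\mathcal F\theta(\xi)\|_{L^2(\mathbb R)}$. Say that $\theta$ is band-limited to $[-T,T]$ if $\mathcal F\theta(2\pi n)=0$ for all $n\in\mathbb Z$ with $2\pi|n|>T$, that is, if the Fourier series of $\theta$ on $(0,1)$ contains only frequencies $2\pi n\in[-T,T]$. (This holds in particular if $\operatorname{supp}\mathcal F\theta\subset[-T,T]$.) For a function $\rho$ on $(0,1)$ with weak derivative $\rho_x$, and $\kappa,\varepsilon>0$, $\lambda\ge 0$, let $$Bw=\frac1{\rho_x}\Big(\varepsilon\Big(\frac w{\rho_x}\Big)_{xxxx}-\lambda\Big(\frac w{\rho_x}\Big)_{xx}+\frac w{\rho_x}\,(\kappa+\rho_x^2)\Big),$$ with domain the $w\in L^2(0,1)$ such that $w/\rho_x\in H^4(0,1)$ and both $w/\rho_x$ and $(w/\rho_x)_{xx}$ vanish at $0$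 and $1$. The operator $I-B^{-1}$ is the Hessian operator of the squared HV distance with parameters $\kappa,\lambda,\varepsilon$ at $\rho$. **Theorem.** For every $T>0$ there are $\lambda_0,\varepsilon_0>0$ depending only on $T$, and for every $K\in\mathbb R$ a $\kappa_0>K$ depending only on $T$ and $K$ (so $\kappa_0$ can be chosen above any prescribed value, in particular above $m^2$), with the following property. Let $\rho_x\in H^2(0,1)$ satisfy $0<m\le|\rho_x|\le M$ almost everywhere. Then there are constants $\tilde C_1,\tilde C_2>0$ such that for all $\kappa\in(m^2,\kappa_0)$, all $0\le\lambda\le\lambda_0$, all $0<\varepsilon\le\varepsilon_0$ and all $\theta\in L^2(0,1)$ band-limited to $[-T,T]$, the equation $Bw=\theta$ has a unique solution $w=B^{-1}\theta$, and $$\tilde C_1\|\theta\|_{H^{-2}}^2\le\langle\theta,(I-B^{-1})\theta\rangle_{L^2(0,1)}\le\tilde C_2\|\theta\|_{H^{-2}}^2,$$ where moreover $\tilde C_1\|\theta\|_{H^{-2}}^2>0$ unless $\theta=0$. -/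

import Mathlib

open MeasureTheory Set
open scoped ContDiff

noncomputable section

/-- Lebesgue measure on the interval `(0,1)`. Functions on `(0,1)` are represented by functions
`ℝ → ℝ`, of which only the restriction to `(0,1)`, up to null sets, matters. -/
def unitMeasure : Measure ℝ := volume.restrict (Ioo (0 : ℝ) 1)

/-- `g` is the weak derivative of order `k` of `u` on `(0,1)`. -/
def IsWeakDeriv (k : ℕ) (u g : ℝ → ℝ) : Prop :=
  LocallyIntegrableOn u (Ioo (0 : ℝ) 1) ∧ LocallyIntegrableOn g (Ioo (0 : ℝ) 1) ∧
    ∀ φ : ℝ → ℝ, ContDiff ℝ ∞ φ → HasCompactSupport φ → tsupport φ ⊆ Ioo (0 : ℝ) 1 →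
      ∫ x, u x * iteratedDeriv k φ x ∂unitMeasure = (-1) ^ k * ∫ x, g x * φ x ∂unitMeasure

/-- `u` belongs to the Sobolev space `H^k(0,1)`: its weak derivatives of order `0, …, k` exist and
are square integrable. -/
def MemSobolev (k : ℕ) (u : ℝ → ℝ) : Prop :=
  ∀ j ≤ k, ∃ g : ℝ → ℝ, MemLp g 2 unitMeasure ∧ IsWeakDeriv j u g

/-- The boundary condition `u(0) = u(1) = 0`, read off from the continuous representative of `u`
on `[0,1]`. -/
def VanishesAtEndpoints (u : ℝ → ℝ) : Prop :=
  ∃ U : ℝ → ℝ, ContinuousOn U (Icc (0 : ℝ) 1) ∧ U =ᵐ[unitMeasure] u ∧ U 0 = 0 ∧ U 1 = 0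

/-- `w` lies in the domain of the operator
`B w = r⁻¹ (ε (w/r)'''' - lam (w/r)'' + (κ + r²) (w/r))` and `B w = θ`, where `r` stands for `ρ_x`.
The domain consists of the `w ∈ L²(0,1)` with `u = w/r ∈ H⁴(0,1)` such that `u` and `u''` vanish
at `0` and `1`. (If `r` is continuous without zeros on `[0,1]`, then `u` vanishes at the endpoints
if and only if `w` does.) -/
def IsBPreimage (ε lam κ : ℝ) (r θ w : ℝ → ℝ) : Prop :=
  MemLp w 2 unitMeasure ∧ MemSobolev 4 (fun x => w x / r x) ∧
    ∃ u₂ u₄ : ℝ → ℝ,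
      IsWeakDeriv 2 (fun x => w x / r x) u₂ ∧ IsWeakDeriv 4 (fun x => w x / r x) u₄ ∧
      VanishesAtEndpoints (fun x => w x / r x) ∧ VanishesAtEndpoints u₂ ∧
      (fun x => 1 / r x * (ε * u₄ x - lam * u₂ x + w x / r x * (κ + r x ^ 2)))
        =ᵐ[unitMeasure] θ

/-- The (unitary) Fourier transform of a function on `(0,1)` extended by zero, in terms of the
angular frequency `ξ`. Its values at `ξ ∈ 2πℤ` are, up to the factor `(2π)^{-1/2}`, the Fourier
coefficients of the function on the interval. -/
def fourierTransform (θ : ℝ → ℝ) (ξ : ℝ) : ℂ :=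
  (((√(2 * Real.pi))⁻¹ : ℝ) : ℂ) *
    ∫ x, Complex.exp (-(Complex.I * (ξ : ℂ) * (x : ℂ))) * (θ x : ℂ) ∂unitMeasure

/-- The norm `‖θ‖_{H^{-2}} = ‖(1 + |ξ|²)⁻¹ (Fθ)(ξ)‖_{L²(ℝ)}`. -/
def hNegTwoNorm (θ : ℝ → ℝ) : ℝ :=
  √(∫ ξ : ℝ, ((1 + ξ ^ 2)⁻¹ * ‖fourierTransform θ ξ‖) ^ 2)

/-- `θ` is band-limited on `(0,1)` with band `[-T,T]`: among the frequencies `2πn`, `n ∈ ℤ`, of the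
interval, only those in `[-T,T]` occur in `θ`. This is implied by the vanishing of the Fourier
transform at every real frequency outside `[-T,T]`, which would force `θ = 0`. -/
def IsBandLimited (T : ℝ) (θ : ℝ → ℝ) : Prop :=
  ∀ n : ℤ, 2 * Real.pi * (n : ℝ) ∉ Icc (-T) T → fourierTransform θ (2 * Real.pi * (n : ℝ)) = 0

end

/-!
With `r = ρ_x`, `u = w / r`, `q = κ + r²` and `f = r θ`, the equation `B w = θ` is the Dirichlet
type problem `ε u'''' - lam u'' + q u = f`, `u = u'' = 0` at the endpoints.

*Solvability.* Let `G` be the Green operator of `-d²/dx²` with Dirichlet conditions. It is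
symmetric and positive, since its bilinear form is the covariance of primitives
(`integral_green_mul`). With `v = -u''`, so that `u = G v`, applying `G` to the equation gives
`ε v + lam G v + G (q G v) = G f`. The operator on the left is bounded and coercive on `L²(0,1)`,
hence onto (`exists_isGreenSolution`). Uniqueness follows from the energy identity
(`IsGreenSolution.energy`); that every weak solution has the form `u = G v` is du Bois-Reymond's
lemma (`exists_ae_eq_affine`, `ae_eq_green_of_isWeakDeriv`).

*Quadratic form.* The energy identity gives `0 ≤ ∫ q u² ≤ ∫ f u = ⟨θ, B⁻¹ θ⟩`, and therefore
`⟨θ, (I - B⁻¹) θ⟩ ≤ ∫ θ²`. It also gives `∫ f u ≤ 2 ∫ f u - ∫ q u²`, and completing the square,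
`⟨θ, (I - B⁻¹) θ⟩ ≥ ∫ (κ / q) θ² ≥ m² / (m² + M²) ∫ θ²` (`IsGreenSolution.integral_bounds`).

*Norms.* By completeness of the trigonometric system a function band-limited to `[-T,T]` is
determined by finitely many Fourier coefficients. On the resulting finite-dimensional space the
`L²` norm is equivalent to the `H⁻²` norm, with constants depending on `T` only
(`exists_hNegTwoNorm_equiv`).
-/

/-! ### Test functions and weak derivatives -/

/-- `φ` is a test function on `(0,1)`: smooth, with compact support inside the interval. -/
def IsTestFunction (φ : ℝ → ℝ) : Prop :=
  ContDiff ℝ ∞ φ ∧ HasCompactSupport φ ∧ tsupport φ ⊆ Ioo (0 : ℝ) 1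

instance isProbabilityMeasure_unitMeasure : IsProbabilityMeasure unitMeasure :=
  ⟨by simp [unitMeasure]⟩

lemma integral_unitMeasure {E : Type*} [NormedAddCommGroup E] [NormedSpace ℝ E] (f : ℝ → E) :
    ∫ x, f x ∂unitMeasure = ∫ x in (0 : ℝ)..1, f x := by
  rw [intervalIntegral.integral_of_le zero_le_one, unitMeasure, integral_Ioc_eq_integral_Ioo]

lemma intervalIntegrable_of_unitMeasure {f : ℝ → ℝ} (hf : Integrable f unitMeasure) :
    IntervalIntegrable f volume 0 1 := by
  rwa [intervalIntegrable_iff_integrableOn_Ioo_of_le zero_le_one]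

lemma integrable_of_continuousOn {f : ℝ → ℝ} (hf : ContinuousOn f (Icc 0 1)) :
    Integrable f unitMeasure :=
  (hf.integrableOn_Icc (μ := volume)).mono_set Ioo_subset_Icc_self

lemma locallyIntegrableOn_of_integrable {f : ℝ → ℝ} (hf : Integrable f unitMeasure) :
    LocallyIntegrableOn f (Ioo (0 : ℝ) 1) :=
  IntegrableOn.locallyIntegrableOn hf

namespace IsTestFunction

variable {φ ψ : ℝ → ℝ}

lemma continuous (h : IsTestFunction φ) : Continuous φ := h.1.continuous

lemma eq_zero (h : IsTestFunction φ) {x : ℝ} (hx : x ∉ Ioo (0 : ℝ) 1) : φ x = 0 :=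
  image_eq_zero_of_notMem_tsupport fun h' => hx (h.2.2 h')

lemma deriv (h : IsTestFunction φ) : IsTestFunction (deriv φ) :=
  ⟨(contDiff_infty_iff_deriv.1 h.1).2, h.2.1.deriv,
    tsupport_deriv_subset.trans h.2.2⟩

lemma iteratedDeriv (h : IsTestFunction φ) (k : ℕ) : IsTestFunction (iteratedDeriv k φ) := by
  induction k with
  | zero => simpa using h
  | succ k ih => rw [iteratedDeriv_succ]; exact ih.deriv

lemma sub_const_mul (h : IsTestFunction φ) (h' : IsTestFunction ψ) (c : ℝ) :
    IsTestFunction (fun x => φ x - c * ψ x) := by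
  refine ⟨h.1.sub (contDiff_const.mul h'.1), h.2.1.sub h'.2.1.mul_left, ?_⟩
  refine (tsupport_sub φ (fun x => c * ψ x)).trans (union_subset h.2.2 ?_)
  exact (tsupport_mul_subset_right (f := fun _ => c)).trans h'.2.2

lemma integrable_mul (h : IsTestFunction φ) {f : ℝ → ℝ}
    (hf : LocallyIntegrableOn f (Ioo (0 : ℝ) 1)) :
    Integrable (fun x => f x * φ x) unitMeasure := by
  have hK : IntegrableOn f (tsupport φ) volume := hf.integrableOn_compact_subset h.2.2 h.2.1
  have h1 : IntegrableOn (fun x => f x * φ x) (tsupport φ) volume :=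
    hK.mul_continuousOn h.continuous.continuousOn h.2.1
  have h2 : Integrable (fun x => f x * φ x) volume := by
    rwa [integrableOn_iff_integrable_of_support_subset] at h1
    intro x hx
    exact subset_tsupport _ (right_ne_zero_of_mul hx)
  exact h2.restrict

lemma integrable (h : IsTestFunction φ) : Integrable φ unitMeasure :=
  integrable_of_continuousOn h.continuous.continuousOn

lemma integral_deriv (h : IsTestFunction φ) : ∫ x, _root_.deriv φ x ∂unitMeasure = 0 := by
  rw [integral_unitMeasure, intervalIntegral.integral_deriv_eq_sub
    (fun x _ => (h.1.differentiable (by simp)).differentiableAt)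
    (h.deriv.continuous.intervalIntegrable _ _), h.eq_zero (by simp), h.eq_zero (by simp), sub_zero]

/-- A test function with mean zero is the derivative of a test function, namely of its
primitive from `0`. -/
lemma exists_deriv_eq (h : IsTestFunction ψ) (h0 : ∫ x, ψ x ∂unitMeasure = 0) :
    ∃ φ, IsTestFunction φ ∧ _root_.deriv φ = ψ := by
  set φ : ℝ → ℝ := fun x => ∫ t in (0 : ℝ)..x, ψ t with hφ
  have hd : ∀ x, HasDerivAt φ (ψ x) x := fun x =>
    h.continuous.integral_hasStrictDerivAt 0 x |>.hasDerivAt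
  have hderiv : _root_.deriv φ = ψ := funext fun x => (hd x).deriv
  -- the support of `ψ` lies in some `[a,b] ⊆ (0,1)`
  obtain ⟨a, b, ha, hab, hb, hs⟩ : ∃ a b : ℝ, 0 < a ∧ a ≤ b ∧ b < 1 ∧ tsupport ψ ⊆ Icc a b := by
    rcases (tsupport ψ).eq_empty_or_nonempty with he | hne
    · exact ⟨1 / 2, 1 / 2, by norm_num, le_rfl, by norm_num, by simp [he]⟩
    · obtain ⟨a, ha, ha'⟩ := h.2.1.isCompact.exists_isLeast hne
      obtain ⟨b, hb, hb'⟩ := h.2.1.isCompact.exists_isGreatest hne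
      exact ⟨a, b, (h.2.2 ha).1, ha' hb, (h.2.2 hb).2, fun x hx => ⟨ha' hx, hb' hx⟩⟩
  have hz : ∀ x, x ∉ Icc a b → ψ x = 0 := fun x hx =>
    image_eq_zero_of_notMem_tsupport fun h' => hx (hs h')
  have hφa : ∀ x, x < a → φ x = 0 := by
    intro x hx
    refine (intervalIntegral.integral_congr (g := fun _ => 0) fun t ht => hz t fun h' => ?_).trans
      (by simp)
    have := ht.2
    have := h'.1
    rcases max_cases (0 : ℝ) x with h1 | h1 <;> linarith
  have hφb : ∀ x, b < x → φ x = 0 := by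
    intro x hx
    have h1 : φ 1 = 0 := by rw [hφ]; simp only; rw [← integral_unitMeasure, h0]
    have h2 : φ 1 - φ x = ∫ t in x..1, ψ t :=
      intervalIntegral.integral_interval_sub_left (h.continuous.intervalIntegrable _ _)
        (h.continuous.intervalIntegrable _ _)
    have h3 : ∫ t in x..1, ψ t = 0 := by
      refine (intervalIntegral.integral_congr (g := fun _ => 0) fun t ht => hz t fun h' => ?_).trans
        (by simp)
      have := ht.1
      have := h'.2
      rcases min_cases x (1 : ℝ) with h1 | h1 <;> linarith
    linarith
  have hts : tsupport φ ⊆ Icc a b := by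
    refine closure_minimal (fun x hx => ?_) isClosed_Icc
    by_contra hcon
    rw [mem_Icc, not_and_or, not_le, not_le] at hcon
    exact hx (hcon.elim (hφa x) (hφb x))
  refine ⟨φ, ⟨?_, HasCompactSupport.of_support_subset_isCompact isCompact_Icc
    ((subset_tsupport φ).trans hts), hts.trans fun x hx => ⟨by linarith [hx.1], by linarith [hx.2]⟩⟩,
    hderiv⟩
  rw [contDiff_infty_iff_deriv, hderiv]
  exact ⟨fun x => (hd x).differentiableAt, h.1⟩

end IsTestFunction

lemma exists_isTestFunction_integral_eq_one :
    ∃ η, IsTestFunction η ∧ ∫ x, η x ∂unitMeasure = 1 := by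
  let f : ContDiffBump (1 / 2 : ℝ) := ⟨1 / 8, 1 / 4, by norm_num, by norm_num⟩
  have hs : tsupport (f.normed volume) ⊆ Ioo (0 : ℝ) 1 := by
    rw [f.tsupport_normed_eq, Real.closedBall_eq_Icc]
    intro x hx
    simp only [f, mem_Icc] at hx
    constructor <;> linarith [hx.1, hx.2]
  refine ⟨f.normed volume, ⟨f.contDiff_normed, f.hasCompactSupport_normed, hs⟩, ?_⟩
  rw [unitMeasure, setIntegral_eq_integral_of_forall_compl_eq_zero, f.integral_normed]
  exact fun x hx => image_eq_zero_of_notMem_tsupport fun h' => hx (hs h')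

/-- The fundamental lemma of the calculus of variations on `(0,1)`. -/
lemma ae_eq_of_forall_integral_mul_eq {f g : ℝ → ℝ}
    (hf : LocallyIntegrableOn f (Ioo (0 : ℝ) 1)) (hg : LocallyIntegrableOn g (Ioo (0 : ℝ) 1))
    (h : ∀ φ, IsTestFunction φ → ∫ x, f x * φ x ∂unitMeasure = ∫ x, g x * φ x ∂unitMeasure) :
    f =ᵐ[unitMeasure] g := by
  have key := isOpen_Ioo.ae_eq_zero_of_integral_contDiff_smul_eq_zero (μ := volume) (hf.sub hg)
    fun φ h1 h2 h3 => ?_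
  · rw [Filter.EventuallyEq, unitMeasure, ae_restrict_iff' measurableSet_Ioo]
    filter_upwards [key] with x hx hx'
    exact sub_eq_zero.1 (hx hx')
  · have hφ : IsTestFunction φ := ⟨h1, h2, h3⟩
    rw [← setIntegral_eq_integral_of_forall_compl_eq_zero (s := Ioo (0 : ℝ) 1)
      fun x hx => by simp [hφ.eq_zero hx]]
    change ∫ x, φ x • (f - g) x ∂unitMeasure = 0
    have : ∀ x, φ x • (f - g) x = f x * φ x - g x * φ x := fun x => by
      simp only [Pi.sub_apply, smul_eq_mul]; ring
    simp_rw [this]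
    rw [integral_sub (hφ.integrable_mul hf) (hφ.integrable_mul hg), h φ hφ, sub_self]

/-- The lemma of du Bois-Reymond: a function whose weak derivative is the constant `c` is affine
with slope `c`. Every test function `ψ` differs by the multiple `(∫ ψ) η` of a fixed one from a
derivative, which determines the functional `ψ ↦ ∫ f ψ`. -/
lemma exists_ae_eq_const_add_mul {f : ℝ → ℝ} (hf : LocallyIntegrableOn f (Ioo (0 : ℝ) 1)) (c : ℝ)
    (h : ∀ φ, IsTestFunction φ →
      ∫ x, f x * deriv φ x ∂unitMeasure = - (c * ∫ x, φ x ∂unitMeasure)) :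
    ∃ a : ℝ, f =ᵐ[unitMeasure] fun x => a + c * x := by
  obtain ⟨η, hη, hη1⟩ := exists_isTestFunction_integral_eq_one
  have hlin : LocallyIntegrableOn (fun x : ℝ => c * x) (Ioo (0 : ℝ) 1) :=
    (by fun_prop : Continuous fun x : ℝ => c * x).locallyIntegrable.locallyIntegrableOn _
  -- the same identity holds for `x ↦ c x`
  have hlin' : ∀ φ, IsTestFunction φ →
      ∫ x, (c * x) * deriv φ x ∂unitMeasure = - (c * ∫ x, φ x ∂unitMeasure) := by
    intro φ hφ
    rw [integral_unitMeasure, integral_unitMeasure,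
      intervalIntegral.integral_mul_deriv_eq_deriv_mul (u' := fun _ => c)
        (fun x _ => by simpa using (hasDerivAt_id x).const_mul c)
        (fun x _ => (hφ.1.differentiable (by simp)).differentiableAt.hasDerivAt)
        intervalIntegrable_const (hφ.deriv.continuous.intervalIntegrable _ _),
      hφ.eq_zero (x := 0) (by simp), hφ.eq_zero (x := 1) (by simp),
      intervalIntegral.integral_const_mul]
    ring
  set a : ℝ := ∫ x, (f x - c * x) * η x ∂unitMeasure with ha
  refine ⟨a, ?_⟩
  have hcont : LocallyIntegrableOn (fun x : ℝ => a + c * x) (Ioo (0 : ℝ) 1) :=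
    (by fun_prop : Continuous fun x : ℝ => a + c * x).locallyIntegrable.locallyIntegrableOn _
  refine ae_eq_of_forall_integral_mul_eq hf hcont fun ψ hψ => ?_
  set s := ∫ x, ψ x ∂unitMeasure with hs
  have hχ := hψ.sub_const_mul hη s
  obtain ⟨φ, hφ, hφ'⟩ := hχ.exists_deriv_eq (by
    rw [integral_sub hψ.integrable (hη.integrable.const_mul s), integral_const_mul, hη1]; simp [hs])
  have e1 := h φ hφ
  rw [← hlin' φ hφ, hφ'] at e1
  have e2 : ∀ g : ℝ → ℝ, LocallyIntegrableOn g (Ioo (0 : ℝ) 1) →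
      ∫ x, g x * (ψ x - s * η x) ∂unitMeasure =
        ∫ x, g x * ψ x ∂unitMeasure - s * ∫ x, g x * η x ∂unitMeasure := by
    intro g hg
    rw [← integral_const_mul, ← integral_sub (hψ.integrable_mul hg)
      ((hη.integrable_mul hg).const_mul s)]
    exact integral_congr_ae (.of_forall fun x => by simp only; ring)
  rw [e2 f hf, e2 _ hlin] at e1
  have e3 : a = ∫ x, f x * η x ∂unitMeasure - ∫ x, c * x * η x ∂unitMeasure := by
    rw [ha, ← integral_sub (hη.integrable_mul hf) (hη.integrable_mul hlin)]
    exact integral_congr_ae (.of_forall fun x => by simp only; ring)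
  have e4 : ∫ x, (a + c * x) * ψ x ∂unitMeasure = a * s + ∫ x, c * x * ψ x ∂unitMeasure := by
    rw [hs, ← integral_const_mul, ← integral_add (hψ.integrable.const_mul a)
      (hψ.integrable_mul hlin)]
    exact integral_congr_ae (.of_forall fun x => by simp only; ring)
  rw [e4, e3]
  linear_combination e1

/-- A function whose second weak derivative vanishes is affine. -/
lemma exists_ae_eq_affine {f : ℝ → ℝ} (hf : LocallyIntegrableOn f (Ioo (0 : ℝ) 1))
    (h : ∀ φ, IsTestFunction φ → ∫ x, f x * iteratedDeriv 2 φ x ∂unitMeasure = 0) :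
    ∃ a c : ℝ, f =ᵐ[unitMeasure] fun x => a + c * x := by
  obtain ⟨η, hη, hη1⟩ := exists_isTestFunction_integral_eq_one
  set c : ℝ := - ∫ x, f x * deriv η x ∂unitMeasure with hc
  refine (exists_ae_eq_const_add_mul hf c fun ψ hψ => ?_).imp fun a ha => ⟨c, ha⟩
  set s := ∫ x, ψ x ∂unitMeasure with hs
  obtain ⟨φ, hφ, hφ'⟩ := (hψ.sub_const_mul hη s).exists_deriv_eq (by
    rw [integral_sub hψ.integrable (hη.integrable.const_mul s), integral_const_mul, hη1]; simp [hs])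
  have e1 := h φ hφ
  have e2 : iteratedDeriv 2 φ = fun x => deriv ψ x - s * deriv η x := by
    rw [iteratedDeriv_succ, iteratedDeriv_one, hφ']
    funext x
    have d1 := (hψ.1.differentiable (by simp)).differentiableAt (x := x)
    have d2 := (hη.1.differentiable (by simp)).differentiableAt (x := x)
    exact (d1.hasDerivAt.sub (d2.hasDerivAt.const_mul s)).deriv
  simp_rw [e2, mul_sub] at e1
  rw [integral_sub (hψ.deriv.integrable_mul hf)
    (((hη.deriv.integrable_mul hf).const_mul s).congr
      (.of_forall fun x => by simp only; ring))] at e1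
  have e3 : ∫ x, f x * (s * deriv η x) ∂unitMeasure = s * ∫ x, f x * deriv η x ∂unitMeasure := by
    rw [← integral_const_mul]
    exact integral_congr_ae (.of_forall fun x => by simp only; ring)
  rw [e3] at e1
  rw [hc]
  linear_combination e1

lemma iteratedDeriv_iteratedDeriv (φ : ℝ → ℝ) (j k : ℕ) :
    iteratedDeriv j (iteratedDeriv k φ) = iteratedDeriv (j + k) φ := by
  simp only [iteratedDeriv_eq_iterate, Function.iterate_add_apply]

lemma locallyIntegrableOn_congr_ae {u v : ℝ → ℝ} (hu : LocallyIntegrableOn u (Ioo (0 : ℝ) 1))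
    (h : u =ᵐ[unitMeasure] v) : LocallyIntegrableOn v (Ioo (0 : ℝ) 1) := by
  rw [locallyIntegrableOn_iff isOpen_Ioo.isLocallyClosed] at hu ⊢
  exact fun K hK hKc => (hu K hK hKc).congr_fun_ae (ae_restrict_of_ae_restrict_of_subset hK h)

namespace IsWeakDeriv

variable {j k : ℕ} {u v g h : ℝ → ℝ}

lemma ae_unique (h1 : IsWeakDeriv k u g) (h2 : IsWeakDeriv k u h) : g =ᵐ[unitMeasure] h := by
  refine ae_eq_of_forall_integral_mul_eq h1.2.1 h2.2.1 fun φ hφ => ?_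
  have := (h1.2.2 φ hφ.1 hφ.2.1 hφ.2.2).symm.trans (h2.2.2 φ hφ.1 hφ.2.1 hφ.2.2)
  exact mul_left_cancel₀ (pow_ne_zero k (by norm_num)) this

lemma trans (h1 : IsWeakDeriv j u g) (h2 : IsWeakDeriv k g h) : IsWeakDeriv (j + k) u h := by
  refine ⟨h1.1, h2.2.1, fun φ p1 p2 p3 => ?_⟩
  have hφ : IsTestFunction φ := ⟨p1, p2, p3⟩
  have q := hφ.iteratedDeriv k
  rw [← iteratedDeriv_iteratedDeriv, h1.2.2 _ q.1 q.2.1 q.2.2, h2.2.2 φ p1 p2 p3, pow_add, mul_assoc]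

/-- If `g` and `h` are the weak derivatives of `u` of order `j` and `j + k`, then `h` is the weak
derivative of `g` of order `k`. -/
lemma of_add (h1 : IsWeakDeriv j u g) (h2 : IsWeakDeriv (j + k) u h) : IsWeakDeriv k g h := by
  refine ⟨h1.2.1, h2.2.1, fun φ p1 p2 p3 => ?_⟩
  have hφ : IsTestFunction φ := ⟨p1, p2, p3⟩
  have q := hφ.iteratedDeriv k
  have e1 := h1.2.2 _ q.1 q.2.1 q.2.2
  rw [iteratedDeriv_iteratedDeriv, h2.2.2 φ p1 p2 p3, pow_add, mul_assoc] at e1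
  exact (mul_left_cancel₀ (pow_ne_zero j (by norm_num)) e1).symm

lemma congr (h1 : IsWeakDeriv k u g) (hu : u =ᵐ[unitMeasure] v) (hg : g =ᵐ[unitMeasure] h) :
    IsWeakDeriv k v h := by
  refine ⟨locallyIntegrableOn_congr_ae h1.1 hu, locallyIntegrableOn_congr_ae h1.2.1 hg,
    fun φ p1 p2 p3 => ?_⟩
  rw [← integral_congr_ae (g := fun x => v x * iteratedDeriv k φ x)
      (f := fun x => u x * iteratedDeriv k φ x) (by filter_upwards [hu] with x hx; rw [hx]),
    ← integral_congr_ae (g := fun x => h x * φ x) (f := fun x => g x * φ x)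
      (by filter_upwards [hg] with x hx; rw [hx])]
  exact h1.2.2 φ p1 p2 p3

lemma zero (hu : LocallyIntegrableOn u (Ioo (0 : ℝ) 1)) : IsWeakDeriv 0 u u :=
  ⟨hu, hu, fun φ _ _ _ => by simp⟩

lemma ae_eq_of_zero (h1 : IsWeakDeriv 0 u g) : g =ᵐ[unitMeasure] u :=
  h1.ae_unique (zero h1.1)

lemma neg (h1 : IsWeakDeriv k u g) : IsWeakDeriv k (fun x => - u x) (fun x => - g x) := by
  refine ⟨h1.1.neg, h1.2.1.neg, fun φ p1 p2 p3 => ?_⟩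
  simp only [neg_mul, integral_neg, h1.2.2 φ p1 p2 p3, mul_neg]

end IsWeakDeriv

/-! ### The Green operator of the Dirichlet problem -/

/-- The primitive of `f` that vanishes at `0`. -/
noncomputable def prim (f : ℝ → ℝ) (x : ℝ) : ℝ := ∫ t in (0 : ℝ)..x, f t

/-- The solution `u` of `-u'' = f`, `u 0 = u 1 = 0`, obtained by integrating twice. -/
noncomputable def green (f : ℝ → ℝ) (x : ℝ) : ℝ := prim (prim f) 1 * x - prim (prim f) x

lemma integral_unitMeasure_eq_prim (f : ℝ → ℝ) : ∫ x, f x ∂unitMeasure = prim f 1 :=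
  integral_unitMeasure f

lemma continuousOn_prim {f : ℝ → ℝ} (hf : Integrable f unitMeasure) :
    ContinuousOn (prim f) (Icc 0 1) := by
  have := intervalIntegral.continuousOn_primitive_interval (a := 0) (b := 1) (μ := volume) (f := f)
    (by rw [uIcc_of_le zero_le_one, integrableOn_Icc_iff_integrableOn_Ioo]; exact hf)
  rwa [uIcc_of_le zero_le_one] at this

lemma integrable_prim {f : ℝ → ℝ} (hf : Integrable f unitMeasure) :
    Integrable (prim f) unitMeasure :=
  integrable_of_continuousOn (continuousOn_prim hf)

lemma continuousOn_green {f : ℝ → ℝ} (hf : Integrable f unitMeasure) :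
    ContinuousOn (green f) (Icc 0 1) :=
  (by fun_prop : Continuous fun x => prim (prim f) 1 * x).continuousOn.sub
    (continuousOn_prim (integrable_prim hf))

lemma green_zero (f : ℝ → ℝ) : green f 0 = 0 := by simp [green, prim]

lemma green_one (f : ℝ → ℝ) : green f 1 = 0 := by simp [green]

lemma memLp_of_continuousOn {f : ℝ → ℝ} (hf : ContinuousOn f (Icc 0 1)) :
    MemLp f 2 unitMeasure := by
  obtain ⟨C, hC⟩ := isCompact_Icc.exists_bound_of_continuousOn hf
  refine MemLp.of_bound (integrable_of_continuousOn hf).aestronglyMeasurable C ?_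
  rw [unitMeasure, ae_restrict_iff' measurableSet_Ioo]
  exact .of_forall fun x hx => hC x (Ioo_subset_Icc_self hx)

lemma prim_congr_ae {f g : ℝ → ℝ} (h : f =ᵐ[unitMeasure] g) {x : ℝ} (hx : x ∈ Icc (0 : ℝ) 1) :
    prim f x = prim g x := by
  refine intervalIntegral.integral_congr_ae ?_
  rw [unitMeasure, Filter.EventuallyEq, ae_restrict_iff' measurableSet_Ioo] at h
  filter_upwards [h, compl_mem_ae_iff.2 (measure_singleton (1 : ℝ))] with t ht h1 ht'
  rw [uIoc_of_le hx.1] at ht'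
  exact ht ⟨ht'.1, lt_of_le_of_ne (ht'.2.trans hx.2) h1⟩

lemma prim_congr {f g : ℝ → ℝ} (h : EqOn f g (Icc 0 1)) {x : ℝ} (hx : x ∈ Icc (0 : ℝ) 1) :
    prim f x = prim g x := by
  refine prim_congr_ae ?_ hx
  rw [unitMeasure, Filter.EventuallyEq, ae_restrict_iff' measurableSet_Ioo]
  exact .of_forall fun t ht => h (Ioo_subset_Icc_self ht)

lemma green_congr_ae {f g : ℝ → ℝ} (h : f =ᵐ[unitMeasure] g) {x : ℝ} (hx : x ∈ Icc (0 : ℝ) 1) :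
    green f x = green g x := by
  have h1 : EqOn (prim f) (prim g) (Icc 0 1) := fun t ht => prim_congr_ae h ht
  rw [green, green, prim_congr h1 hx, prim_congr h1 (by simp)]

lemma prim_add {f g : ℝ → ℝ} (hf : Integrable f unitMeasure) (hg : Integrable g unitMeasure)
    {x : ℝ} (hx : x ∈ Icc (0 : ℝ) 1) :
    prim (fun t => f t + g t) x = prim f x + prim g x :=
  intervalIntegral.integral_add
    ((intervalIntegrable_of_unitMeasure hf).mono_set (by
      rw [uIcc_of_le hx.1, uIcc_of_le zero_le_one]; exact Icc_subset_Icc_right hx.2))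
    ((intervalIntegrable_of_unitMeasure hg).mono_set (by
      rw [uIcc_of_le hx.1, uIcc_of_le zero_le_one]; exact Icc_subset_Icc_right hx.2))

lemma prim_const_mul (c : ℝ) (f : ℝ → ℝ) (x : ℝ) : prim (fun t => c * f t) x = c * prim f x :=
  intervalIntegral.integral_const_mul c f

lemma green_add {f g : ℝ → ℝ} (hf : Integrable f unitMeasure) (hg : Integrable g unitMeasure)
    {x : ℝ} (hx : x ∈ Icc (0 : ℝ) 1) :
    green (fun t => f t + g t) x = green f x + green g x := by
  have h : ∀ y ∈ Icc (0 : ℝ) 1,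
      prim (prim fun t => f t + g t) y = prim (prim f) y + prim (prim g) y := fun y hy => by
    rw [prim_congr (fun t ht => prim_add hf hg ht) hy,
      prim_add (integrable_prim hf) (integrable_prim hg) hy]
  rw [green, green, green, h x hx, h 1 (by simp)]
  ring

lemma green_const_mul (c : ℝ) (f : ℝ → ℝ) (x : ℝ) :
    green (fun t => c * f t) x = c * green f x := by
  have h : prim (fun t => c * f t) = fun t => c * prim f t := funext fun t => prim_const_mul c f t
  rw [green, green, h, prim_const_mul, prim_const_mul]
  ring

/-- Integration by parts for primitives of integrable functions. -/
lemma integral_prim_mul {f g : ℝ → ℝ} (hf : Integrable f unitMeasure)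
    (hg : Integrable g unitMeasure) :
    ∫ x, prim f x * g x ∂unitMeasure =
      prim f 1 * prim g 1 - ∫ x, f x * prim g x ∂unitMeasure := by
  have hf' := intervalIntegrable_of_unitMeasure hf
  have hg' := intervalIntegrable_of_unitMeasure hg
  have key := AbsolutelyContinuousOnInterval.integral_mul_deriv_eq_deriv_mul
    (hf'.absolutelyContinuousOnInterval_intervalIntegral (c := 0) (by simp))
    (hg'.absolutelyContinuousOnInterval_intervalIntegral (c := 0) (by simp))
  have e1 : ∫ x in (0 : ℝ)..1, prim f x * deriv (prim g) x = ∫ x in (0 : ℝ)..1, prim f x * g x := by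
    refine intervalIntegral.integral_congr_ae ?_
    filter_upwards [hg'.ae_hasDerivAt_integral] with x hx hx'
    have : deriv (prim g) x = g x := (hx (uIoc_subset_uIcc hx') 0 (by simp)).deriv
    rw [this]
  have e2 : ∫ x in (0 : ℝ)..1, deriv (prim f) x * prim g x = ∫ x in (0 : ℝ)..1, f x * prim g x := by
    refine intervalIntegral.integral_congr_ae ?_
    filter_upwards [hf'.ae_hasDerivAt_integral] with x hx hx'
    have : deriv (prim f) x = f x := (hx (uIoc_subset_uIcc hx') 0 (by simp)).deriv
    rw [this]
  have h0 : prim f 0 = 0 := by simp [prim]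
  rw [integral_unitMeasure, integral_unitMeasure, ← e1, ← e2]
  refine key.trans ?_
  change prim f 1 * prim g 1 - prim f 0 * prim g 0 - _ = _
  rw [h0, zero_mul, sub_zero]
  rfl

lemma integrable_mul_of_continuousOn {f g : ℝ → ℝ} (hf : ContinuousOn f (Icc 0 1))
    (hg : Integrable g unitMeasure) : Integrable (fun x => f x * g x) unitMeasure := by
  obtain ⟨C, hC⟩ := isCompact_Icc.exists_bound_of_continuousOn hf
  refine hg.bdd_mul (integrable_of_continuousOn hf).aestronglyMeasurable (c := C) ?_
  rw [unitMeasure, ae_restrict_iff' measurableSet_Ioo]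
  exact .of_forall fun x hx => hC x (Ioo_subset_Icc_self hx)

/-- The bilinear form of the Green operator is the covariance of the primitives; hence the operator
is symmetric and positive. -/
lemma integral_green_mul {f g : ℝ → ℝ} (hf : Integrable f unitMeasure)
    (hg : Integrable g unitMeasure) :
    ∫ x, green f x * g x ∂unitMeasure =
      ∫ x, prim f x * prim g x ∂unitMeasure -
        (∫ x, prim f x ∂unitMeasure) * ∫ x, prim g x ∂unitMeasure := by
  have h1 : ∫ x, prim (prim f) x * g x ∂unitMeasure =
      prim (prim f) 1 * prim g 1 - ∫ x, prim f x * prim g x ∂unitMeasure :=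
    integral_prim_mul (integrable_prim hf) hg
  -- `x` is the primitive of `1`
  have hx : ∀ x : ℝ, prim (fun _ => 1) x = x := fun x => by simp [prim]
  have h2 : ∫ x, x * g x ∂unitMeasure = prim g 1 - ∫ x, prim g x ∂unitMeasure := by
    have := integral_prim_mul (f := fun _ => 1) (integrable_const 1) hg
    simpa only [hx, one_mul] using this
  have h3 : ∀ x, green f x * g x = prim (prim f) 1 * (x * g x) - prim (prim f) x * g x :=
    fun x => by rw [green]; ring
  simp_rw [h3]
  rw [integral_sub ((integrable_mul_of_continuousOn (continuousOn_id' _) hg).const_mul _)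
    (integrable_mul_of_continuousOn (continuousOn_prim (integrable_prim hf)) hg),
    integral_const_mul, h1, h2, integral_unitMeasure_eq_prim (prim f)]
  ring

lemma integral_green_mul_comm {f g : ℝ → ℝ} (hf : Integrable f unitMeasure)
    (hg : Integrable g unitMeasure) :
    ∫ x, green f x * g x ∂unitMeasure = ∫ x, f x * green g x ∂unitMeasure := by
  simp_rw [mul_comm (f _)]
  rw [integral_green_mul hf hg, integral_green_mul hg hf, mul_comm (∫ x, prim f x ∂unitMeasure)]
  simp_rw [mul_comm (prim f _)]

lemma integral_green_mul_self_nonneg {f : ℝ → ℝ} (hf : Integrable f unitMeasure) :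
    0 ≤ ∫ x, green f x * f x ∂unitMeasure := by
  have hF := continuousOn_prim hf
  set m := ∫ x, prim f x ∂unitMeasure with hm
  have h1 : ∫ x, (prim f x - m) ^ 2 ∂unitMeasure =
      ∫ x, prim f x * prim f x ∂unitMeasure - m * m := by
    have : ∀ x, (prim f x - m) ^ 2 = prim f x * prim f x - 2 * m * prim f x + m ^ 2 :=
      fun x => by ring
    simp_rw [this]
    have i1 : Integrable (fun x => prim f x * prim f x) unitMeasure :=
      integrable_of_continuousOn (hF.mul hF)
    have i2 : Integrable (fun x => 2 * m * prim f x) unitMeasure := (integrable_prim hf).const_mul _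
    have i3 : Integrable (fun x => prim f x * prim f x - 2 * m * prim f x) unitMeasure := i1.sub i2
    rw [integral_add i3 (integrable_const _), integral_sub i1 i2, integral_const_mul,
      integral_const, ← hm]
    simp
    ring
  rw [integral_green_mul hf hf, ← h1]
  exact integral_nonneg fun x => sq_nonneg _

lemma IsTestFunction.prim_deriv {φ : ℝ → ℝ} (h : IsTestFunction φ) (x : ℝ) :
    prim (_root_.deriv φ) x = φ x := by
  rw [prim, intervalIntegral.integral_deriv_eq_sub
    (fun x _ => (h.1.differentiable (by simp)).differentiableAt)
    (h.deriv.continuous.intervalIntegrable _ _), h.eq_zero (x := 0) (by simp), sub_zero]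

lemma isWeakDeriv_prim {f : ℝ → ℝ} (hf : Integrable f unitMeasure) :
    IsWeakDeriv 1 (prim f) f := by
  refine ⟨locallyIntegrableOn_of_integrable (integrable_prim hf),
    locallyIntegrableOn_of_integrable hf, fun φ p1 p2 p3 => ?_⟩
  have hφ : IsTestFunction φ := ⟨p1, p2, p3⟩
  rw [iteratedDeriv_one, integral_prim_mul hf hφ.deriv.integrable, hφ.prim_deriv,
    hφ.eq_zero (x := 1) (by simp)]
  simp_rw [hφ.prim_deriv]
  ring

lemma isWeakDeriv_one_green {f : ℝ → ℝ} (hf : Integrable f unitMeasure) :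
    IsWeakDeriv 1 (green f) (fun x => prim (prim f) 1 - prim f x) := by
  have hc : Integrable (fun x => prim (prim f) 1 - prim f x) unitMeasure :=
    (integrable_const _).sub (integrable_prim hf)
  refine (isWeakDeriv_prim hc).congr ?_ .rfl
  rw [unitMeasure, Filter.EventuallyEq, ae_restrict_iff' measurableSet_Ioo]
  refine .of_forall fun x hx => ?_
  rw [green, prim, intervalIntegral.integral_sub intervalIntegrable_const]
  · simp [prim, mul_comm]
  · refine (intervalIntegrable_of_unitMeasure (integrable_prim hf)).mono_set ?_
    rw [uIcc_of_le hx.1.le, uIcc_of_le zero_le_one]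
    exact Icc_subset_Icc_right hx.2.le

lemma isWeakDeriv_two_green {f : ℝ → ℝ} (hf : Integrable f unitMeasure) :
    IsWeakDeriv 2 (green f) (fun x => - f x) := by
  refine (isWeakDeriv_one_green hf).trans (k := 1) ⟨locallyIntegrableOn_of_integrable
    ((integrable_const _).sub (integrable_prim hf)), locallyIntegrableOn_of_integrable hf.neg,
    fun φ p1 p2 p3 => ?_⟩
  have hφ : IsTestFunction φ := ⟨p1, p2, p3⟩
  have h1 := (isWeakDeriv_prim hf).2.2 φ p1 p2 p3
  rw [iteratedDeriv_one] at h1 ⊢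
  simp_rw [sub_mul, neg_mul]
  rw [integral_sub (hφ.deriv.integrable.const_mul _)
    (integrable_mul_of_continuousOn (continuousOn_prim hf) hφ.deriv.integrable), h1,
    integral_const_mul, hφ.integral_deriv, integral_neg]
  ring

lemma vanishesAtEndpoints_green {f : ℝ → ℝ} (hf : Integrable f unitMeasure) :
    VanishesAtEndpoints (green f) :=
  ⟨green f, continuousOn_green hf, .rfl, green_zero f, green_one f⟩

lemma VanishesAtEndpoints.congr {u v : ℝ → ℝ} (h : VanishesAtEndpoints u)
    (huv : u =ᵐ[unitMeasure] v) : VanishesAtEndpoints v := by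
  obtain ⟨U, h1, h2, h3, h4⟩ := h
  exact ⟨U, h1, h2.trans huv, h3, h4⟩

/-- Uniqueness for the Dirichlet problem `-u'' = g`: the difference of two weak solutions is
affine and vanishes at the endpoints. -/
lemma ae_eq_green_of_isWeakDeriv {u g : ℝ → ℝ} (hu : VanishesAtEndpoints u)
    (hg : Integrable g unitMeasure) (h : IsWeakDeriv 2 u (fun x => - g x)) :
    u =ᵐ[unitMeasure] green g := by
  obtain ⟨U, hUc, hUu, hU0, hU1⟩ := hu
  have hG := isWeakDeriv_two_green hg
  have hd : LocallyIntegrableOn (fun x => u x - green g x) (Ioo (0 : ℝ) 1) := h.1.sub hG.1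
  obtain ⟨a, c, hac⟩ := exists_ae_eq_affine hd fun φ hφ => by
    have h1 := h.2.2 φ hφ.1 hφ.2.1 hφ.2.2
    have h2 := hG.2.2 φ hφ.1 hφ.2.1 hφ.2.2
    simp_rw [sub_mul]
    rw [integral_sub ((hφ.iteratedDeriv 2).integrable_mul h.1)
      ((hφ.iteratedDeriv 2).integrable_mul hG.1), h1, h2, sub_self]
  -- the two continuous representatives agree on the whole of `[0,1]`
  have hV : ContinuousOn (fun x => U x - green g x) (Icc 0 1) := hUc.sub (continuousOn_green hg)
  have hEq : EqOn (fun x => U x - green g x) (fun x => a + c * x) (Icc (0 : ℝ) 1) := by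
    refine Measure.eqOn_Icc_of_ae_eq (μ := volume) zero_ne_one ?_ hV (by fun_prop)
    rw [← restrict_Ioo_eq_restrict_Icc]
    filter_upwards [hUu, hac] with x hx hx'
    rw [hx, hx']
  have h0 := hEq (left_mem_Icc.2 zero_le_one)
  have h1 := hEq (right_mem_Icc.2 zero_le_one)
  simp only [hU0, hU1, green_zero, green_one] at h0 h1
  have ha : a = 0 := by linarith
  have hc : c = 0 := by linarith
  filter_upwards [hac] with x hx
  rw [ha, hc] at hx
  linarith

/-! ### Solvability of the boundary value problem -/

/-- If `G` and `Q` are symmetric operators with nonnegative quadratic forms, then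
`a + b G + G Q G` is coercive, hence onto. -/
lemma exists_smul_add_smul_add_eq {E : Type*} [NormedAddCommGroup E] [InnerProductSpace ℝ E]
    [CompleteSpace E] {G Q : E →ₗ[ℝ] E} (hG : G.IsSymmetric) (hQ : Q.IsSymmetric)
    (hG0 : ∀ x, 0 ≤ inner ℝ (G x) x) (hQ0 : ∀ x, 0 ≤ inner ℝ (Q x) x)
    {a b : ℝ} (ha : 0 < a) (hb : 0 ≤ b) (y : E) :
    ∃ x, a • x + b • G x + G (Q (G x)) = y := by
  -- an everywhere defined symmetric operator is bounded, by Hellinger-Toeplitz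
  let G' : E →L[ℝ] E := ⟨G, hG.continuous⟩
  let Q' : E →L[ℝ] E := ⟨Q, hQ.continuous⟩
  let S : E →L[ℝ] E := a • ContinuousLinearMap.id ℝ E + b • G' + G' ∘L Q' ∘L G'
  have hS : ∀ x, S x = a • x + b • G x + G (Q (G x)) := fun x => rfl
  have hu : IsUnit S := by
    refine ContinuousLinearMap.isUnit_of_forall_le_norm_inner_map S (c := ⟨a, ha.le⟩) ha fun x => ?_
    refine le_trans ?_ (le_abs_self _)
    have h1 : inner ℝ (G (Q (G x))) x = inner ℝ (Q (G x)) (G x) := hG _ _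
    rw [hS, inner_add_left, inner_add_left, inner_smul_left, inner_smul_left, h1,
      real_inner_self_eq_norm_sq]
    have h2 := mul_nonneg hb (hG0 x)
    have h3 := hQ0 (G x)
    simp only [conj_trivial]
    change ‖x‖ ^ 2 * a ≤ _
    linarith
  obtain ⟨x, hx⟩ := (ContinuousLinearMap.isUnit_iff_bijective.1 hu).2 y
  exact ⟨x, hx⟩

lemma MeasureTheory.MemLp.integrable_two {f : ℝ → ℝ} (hf : MemLp f 2 unitMeasure) :
    Integrable f unitMeasure :=
  hf.integrable one_le_two

lemma MeasureTheory.MemLp.green {f : ℝ → ℝ} (hf : MemLp f 2 unitMeasure) :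
    MemLp (green f) 2 unitMeasure :=
  memLp_of_continuousOn (continuousOn_green hf.integrable_two)

lemma ae_unitMeasure_of_forall_Icc {P : ℝ → Prop} (h : ∀ x ∈ Icc (0 : ℝ) 1, P x) :
    ∀ᵐ x ∂unitMeasure, P x := by
  rw [unitMeasure, ae_restrict_iff' measurableSet_Ioo]
  exact .of_forall fun x hx => h x (Ioo_subset_Icc_self hx)

/-- The Green operator on `L²(0,1)`. -/
noncomputable def greenLp : Lp ℝ 2 unitMeasure →ₗ[ℝ] Lp ℝ 2 unitMeasure where
  toFun p := MemLp.toLp (green p) (Lp.memLp p).green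
  map_add' p q := by
    rw [← MemLp.toLp_add, MemLp.toLp_eq_toLp_iff]
    refine ae_unitMeasure_of_forall_Icc fun x hx => ?_
    rw [Pi.add_apply, ← green_add (Lp.memLp p).integrable_two (Lp.memLp q).integrable_two hx]
    exact green_congr_ae (Lp.coeFn_add p q) hx
  map_smul' c p := by
    rw [RingHom.id_apply, ← MemLp.toLp_const_smul, MemLp.toLp_eq_toLp_iff]
    refine ae_unitMeasure_of_forall_Icc fun x hx => ?_
    rw [Pi.smul_apply, smul_eq_mul, ← green_const_mul]
    exact green_congr_ae (Lp.coeFn_smul c p) hx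

lemma greenLp_ae_eq (p : Lp ℝ 2 unitMeasure) : greenLp p =ᵐ[unitMeasure] green p :=
  (Lp.memLp p).green.coeFn_toLp

lemma inner_greenLp_left (p q : Lp ℝ 2 unitMeasure) :
    inner ℝ (greenLp p) q = ∫ x, green p x * q x ∂unitMeasure := by
  rw [L2.inner_def]
  refine integral_congr_ae ?_
  filter_upwards [greenLp_ae_eq p] with x hx
  rw [hx, RCLike.inner_apply, conj_trivial, mul_comm]

/-- Multiplication by a bounded measurable function on `L²(0,1)`. -/
noncomputable def mulLp {q : ℝ → ℝ} (hq : MemLp q ⊤ unitMeasure) :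
    Lp ℝ 2 unitMeasure →ₗ[ℝ] Lp ℝ 2 unitMeasure where
  toFun p := MemLp.toLp (q * p) ((Lp.memLp p).mul (r := 2) hq)
  map_add' p p' := by
    rw [← MemLp.toLp_add, MemLp.toLp_eq_toLp_iff]
    filter_upwards [Lp.coeFn_add p p'] with x hx
    simp only [Pi.add_apply, Pi.mul_apply, hx]
    ring
  map_smul' c p := by
    rw [RingHom.id_apply, ← MemLp.toLp_const_smul, MemLp.toLp_eq_toLp_iff]
    filter_upwards [Lp.coeFn_smul c p] with x hx
    simp only [Pi.smul_apply, Pi.mul_apply, hx, smul_eq_mul]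
    ring

lemma mulLp_ae_eq {q : ℝ → ℝ} (hq : MemLp q ⊤ unitMeasure) (p : Lp ℝ 2 unitMeasure) :
    mulLp hq p =ᵐ[unitMeasure] fun x => q x * p x :=
  ((Lp.memLp p).mul (r := 2) hq).coeFn_toLp

lemma inner_mulLp_left {q : ℝ → ℝ} (hq : MemLp q ⊤ unitMeasure) (p p' : Lp ℝ 2 unitMeasure) :
    inner ℝ (mulLp hq p) p' = ∫ x, q x * p x * p' x ∂unitMeasure := by
  rw [L2.inner_def]
  refine integral_congr_ae ?_
  filter_upwards [mulLp_ae_eq hq p] with x hx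
  rw [hx, RCLike.inner_apply, conj_trivial, mul_comm]

/-- `v = -u''` and `p = u''''` encode a solution `u = green v` of
`ε u'''' - lam u'' + q u = f` with `u = u'' = 0` at the endpoints. -/
structure IsGreenSolution (ε lam : ℝ) (q f v p : ℝ → ℝ) : Prop where
  memLp_left : MemLp v 2 unitMeasure
  memLp_right : MemLp p 2 unitMeasure
  ae_eq_green : v =ᵐ[unitMeasure] green p
  eqn : (fun x => ε * p x + lam * v x + q x * green v x) =ᵐ[unitMeasure] f

/-- Applying the Green operator to the fourth-order equation turns it into the equation
`ε v + lam G v + G (q G v) = G f` with bounded operators for `v = -u''`. -/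
lemma exists_isGreenSolution {ε lam : ℝ} {q f : ℝ → ℝ} (hε : 0 < ε) (hlam : 0 ≤ lam)
    (hq : MemLp q ⊤ unitMeasure) (hq0 : ∀ᵐ x ∂unitMeasure, 0 ≤ q x)
    (hf : MemLp f 2 unitMeasure) : ∃ v p, IsGreenSolution ε lam q f v p := by
  obtain ⟨v, hv⟩ := exists_smul_add_smul_add_eq (G := greenLp) (Q := mulLp hq)
    (fun x y => by
      rw [real_inner_comm (greenLp y), inner_greenLp_left, inner_greenLp_left, integral_green_mul_comm
        (Lp.memLp x).integrable_two (Lp.memLp y).integrable_two]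
      simp_rw [mul_comm])
    (fun x y => by
      rw [real_inner_comm (mulLp hq y), inner_mulLp_left, inner_mulLp_left]
      exact integral_congr_ae (.of_forall fun t => by simp only; ring))
    (fun x => by
      rw [inner_greenLp_left]
      exact integral_green_mul_self_nonneg (Lp.memLp x).integrable_two)
    (fun x => by
      rw [inner_mulLp_left]
      refine integral_nonneg_of_ae ?_
      filter_upwards [hq0] with t ht
      rw [mul_assoc]
      exact mul_nonneg ht (mul_self_nonneg _)) hε hlam (greenLp hf.toLp)
  set p : Lp ℝ 2 unitMeasure := ε⁻¹ • (hf.toLp - lam • v - mulLp hq (greenLp v)) with hp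
  have hvp : greenLp p = v := by
    rw [hp, map_smul, map_sub, map_sub, map_smul, ← hv]
    have : ε • v + lam • greenLp v + greenLp (mulLp hq (greenLp v)) - lam • greenLp v -
      greenLp (mulLp hq (greenLp v)) = ε • v := by abel
    rw [this, inv_smul_smul₀ hε.ne']
  refine ⟨v, p, Lp.memLp v, Lp.memLp p, ?_, ?_⟩
  · conv_lhs => rw [← hvp]
    exact greenLp_ae_eq p
  · filter_upwards [Lp.coeFn_smul ε⁻¹ (hf.toLp - lam • v - mulLp hq (greenLp v)),
      Lp.coeFn_sub (hf.toLp - lam • v) (mulLp hq (greenLp v)), Lp.coeFn_sub hf.toLp (lam • v),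
      Lp.coeFn_smul lam v, mulLp_ae_eq hq (greenLp v), greenLp_ae_eq v, hf.coeFn_toLp]
      with x h1 h2 h3 h4 h5 h6 h7
    rw [h1, Pi.smul_apply, h2, Pi.sub_apply, h3, Pi.sub_apply, h4, h5, h6, h7, Pi.smul_apply]
    simp only [smul_eq_mul]
    field_simp
    ring

namespace IsGreenSolution

variable {ε lam : ℝ} {q f v p v' p' : ℝ → ℝ}

/-- The energy identity: multiply the equation by `u` and integrate by parts. -/
lemma energy (h : IsGreenSolution ε lam q f v p) (hq : MemLp q ⊤ unitMeasure) :
    ∫ x, f x * green v x ∂unitMeasure = ε * ∫ x, v x ^ 2 ∂unitMeasure +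
      lam * ∫ x, green v x * v x ∂unitMeasure + ∫ x, q x * green v x ^ 2 ∂unitMeasure := by
  have hv := h.memLp_left
  have hp := h.memLp_right
  have i1 : Integrable (fun x => ε * (p x * green v x)) unitMeasure :=
    (hp.integrable_mul hv.green).const_mul ε
  have i2 : Integrable (fun x => lam * (green v x * v x)) unitMeasure :=
    (hv.green.integrable_mul hv).const_mul lam
  have i3 : Integrable (fun x => q x * green v x ^ 2) unitMeasure := by
    have : MemLp (fun x => q x * green v x) 2 unitMeasure := hv.green.mul (r := 2) hq
    exact (this.integrable_mul hv.green).congr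
      (.of_forall fun x => by simp only [Pi.mul_apply]; ring)
  have i12 : Integrable (fun x => ε * (p x * green v x) + lam * (green v x * v x)) unitMeasure :=
    i1.add i2
  have e1 : ∫ x, p x * green v x ∂unitMeasure = ∫ x, v x ^ 2 ∂unitMeasure := by
    rw [← integral_green_mul_comm hp.integrable_two hv.integrable_two]
    refine integral_congr_ae ?_
    filter_upwards [h.ae_eq_green] with x hx
    rw [← hx, sq]
  rw [← e1, ← integral_const_mul, ← integral_const_mul, ← integral_add i1 i2,
    ← integral_add i12 i3]
  refine integral_congr_ae ?_
  filter_upwards [h.eqn] with x hx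
  rw [← hx]
  ring

lemma integral_weight_le (h : IsGreenSolution ε lam q f v p) (hε : 0 ≤ ε) (hlam : 0 ≤ lam)
    (hq : MemLp q ⊤ unitMeasure) :
    ∫ x, q x * green v x ^ 2 ∂unitMeasure ≤ ∫ x, f x * green v x ∂unitMeasure := by
  rw [h.energy hq]
  have h1 : 0 ≤ ∫ x, v x ^ 2 ∂unitMeasure := integral_nonneg fun x => sq_nonneg _
  have h2 := integral_green_mul_self_nonneg h.memLp_left.integrable_two
  nlinarith [mul_nonneg hε h1, mul_nonneg hlam h2]

lemma sub (h : IsGreenSolution ε lam q f v p) (h' : IsGreenSolution ε lam q f v' p') :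
    IsGreenSolution ε lam q (fun _ => 0) (fun x => v x - v' x) (fun x => p x - p' x) := by
  have key : ∀ {g g' : ℝ → ℝ}, Integrable g unitMeasure → Integrable g' unitMeasure →
      ∀ x ∈ Icc (0 : ℝ) 1, green (fun t => g t - g' t) x = green g x - green g' x := by
    intro g g' hg hg' x hx
    have : (fun t => g t - g' t) = fun t => g t + (-1) * g' t := by funext t; ring
    rw [this, green_add hg (hg'.const_mul _) hx, green_const_mul]
    ring
  refine ⟨h.memLp_left.sub h'.memLp_left, h.memLp_right.sub h'.memLp_right, ?_, ?_⟩
  · filter_upwards [h.ae_eq_green, h'.ae_eq_green, ae_unitMeasure_of_forall_Icc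
      (key h.memLp_right.integrable_two h'.memLp_right.integrable_two)] with x h1 h2 h3
    rw [h3, h1, h2]
  · filter_upwards [h.eqn, h'.eqn, ae_unitMeasure_of_forall_Icc
      (key h.memLp_left.integrable_two h'.memLp_left.integrable_two)] with x h1 h2 h3
    rw [h3]
    linear_combination h1 - h2

lemma unique (h : IsGreenSolution ε lam q f v p) (h' : IsGreenSolution ε lam q f v' p')
    (hε : 0 < ε) (hlam : 0 ≤ lam) (hq : MemLp q ⊤ unitMeasure)
    (hq0 : ∀ᵐ x ∂unitMeasure, 0 ≤ q x) : v =ᵐ[unitMeasure] v' := by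
  have hs := h.sub h'
  have e := hs.energy hq
  simp only [zero_mul, integral_zero] at e
  have h1 : 0 ≤ ∫ x, (v x - v' x) ^ 2 ∂unitMeasure := integral_nonneg fun x => sq_nonneg _
  have h2 := mul_nonneg hlam (integral_green_mul_self_nonneg hs.memLp_left.integrable_two)
  have h3 : 0 ≤ ∫ x, q x * green (fun x => v x - v' x) x ^ 2 ∂unitMeasure :=
    integral_nonneg_of_ae (hq0.mono fun x hx => mul_nonneg hx (sq_nonneg _))
  have h4 : ∫ x, (v x - v' x) ^ 2 ∂unitMeasure = 0 := by nlinarith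
  rw [integral_eq_zero_iff_of_nonneg (fun x => sq_nonneg _) hs.memLp_left.integrable_sq] at h4
  filter_upwards [h4] with x hx
  exact sub_eq_zero.1 (pow_eq_zero_iff two_ne_zero |>.1 hx)

end IsGreenSolution

/-- A solution in terms of the Green operator gives a preimage under `B`. -/
lemma IsGreenSolution.isBPreimage {ε lam κ : ℝ} {r θ v p : ℝ → ℝ}
    (hr : MemLp r ⊤ unitMeasure) (hr0 : ∀ᵐ x ∂unitMeasure, r x ≠ 0)
    (h : IsGreenSolution ε lam (fun x => κ + r x ^ 2) (fun x => r x * θ x) v p) :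
    IsBPreimage ε lam κ r θ (fun x => r x * green v x) := by
  have hv := h.memLp_left
  have hp := h.memLp_right
  have hu : green v =ᵐ[unitMeasure] fun x => r x * green v x / r x := by
    filter_upwards [hr0] with x hx
    field_simp
  have hvl : LocallyIntegrableOn (green v) (Ioo (0 : ℝ) 1) :=
    locallyIntegrableOn_of_integrable hv.green.integrable_two
  have d2 : IsWeakDeriv 2 (green v) (fun x => - green p x) :=
    (isWeakDeriv_two_green hv.integrable_two).congr .rfl
      (by filter_upwards [h.ae_eq_green] with x hx; rw [hx])
  have d4 : IsWeakDeriv 4 (green v) p :=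
    (d2.trans (isWeakDeriv_two_green hp.integrable_two).neg).congr .rfl (.of_forall fun x => by simp)
  have d3 := d2.trans (isWeakDeriv_one_green hp.integrable_two).neg
  have cont : ∀ {g : ℝ → ℝ}, MemLp g 2 unitMeasure →
      MemLp (fun x => prim (prim g) 1 - prim g x) 2 unitMeasure := fun hg =>
    memLp_of_continuousOn (continuousOn_const.sub (continuousOn_prim hg.integrable_two))
  refine ⟨hv.green.mul (r := 2) hr, fun j hj => ?_, fun x => - green p x, p, d2.congr hu .rfl,
    d4.congr hu .rfl, (vanishesAtEndpoints_green hv.integrable_two).congr hu, ?_, ?_⟩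
  · interval_cases j
    · exact ⟨_, hv.green, (IsWeakDeriv.zero hvl).congr hu .rfl⟩
    · exact ⟨_, cont hv, (isWeakDeriv_one_green hv.integrable_two).congr hu .rfl⟩
    · exact ⟨_, hp.green.neg, d2.congr hu .rfl⟩
    · exact ⟨_, (cont hp).neg, d3.congr hu .rfl⟩
    · exact ⟨_, hp, d4.congr hu .rfl⟩
  · exact ⟨fun x => - green p x, (continuousOn_green hp.integrable_two).neg, .rfl,
      by simp [green_zero], by simp [green_one]⟩
  · filter_upwards [h.eqn, h.ae_eq_green, hr0] with x h1 h2 h3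
    rw [h2] at h1
    rw [mul_div_cancel_left₀ _ h3]
    field_simp
    linear_combination h1

/-- Conversely every preimage under `B` arises from the Green operator, by uniqueness for the
second-order Dirichlet problem. -/
lemma IsBPreimage.exists_isGreenSolution {ε lam κ : ℝ} {r θ w : ℝ → ℝ}
    (hr0 : ∀ᵐ x ∂unitMeasure, r x ≠ 0) (h : IsBPreimage ε lam κ r θ w) :
    ∃ v p, IsGreenSolution ε lam (fun x => κ + r x ^ 2) (fun x => r x * θ x) v p ∧
      w =ᵐ[unitMeasure] fun x => r x * green v x := by
  obtain ⟨-, hS, u₂, u₄, d2, d4, hu, hu2, heq⟩ := h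
  obtain ⟨g₂, hg₂, hd₂⟩ := hS 2 (by norm_num)
  obtain ⟨g₄, hg₄, hd₄⟩ := hS 4 le_rfl
  have m2 : MemLp u₂ 2 unitMeasure := hg₂.ae_eq (hd₂.ae_unique d2)
  have m4 : MemLp u₄ 2 unitMeasure := hg₄.ae_eq (hd₄.ae_unique d4)
  have dd : IsWeakDeriv 2 u₂ u₄ := d2.of_add d4
  have e1 : (fun x => w x / r x) =ᵐ[unitMeasure] green (fun x => - u₂ x) :=
    ae_eq_green_of_isWeakDeriv hu m2.integrable_two.neg (by simpa using d2)
  have hu2' : VanishesAtEndpoints (fun x => - u₂ x) := by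
    obtain ⟨U, h1, h2, h3, h4⟩ := hu2
    refine ⟨fun x => - U x, h1.neg, ?_, by simp [h3], by simp [h4]⟩
    filter_upwards [h2] with x hx
    rw [hx]
  have e2 : (fun x => - u₂ x) =ᵐ[unitMeasure] green u₄ :=
    ae_eq_green_of_isWeakDeriv hu2' m4.integrable_two dd.neg
  refine ⟨fun x => - u₂ x, u₄, ⟨m2.neg, m4, e2, ?_⟩, ?_⟩
  · filter_upwards [heq, e1, hr0] with x h1 h2 h3
    rw [← h2, ← h1]
    field_simp
    ring
  · filter_upwards [e1, hr0] with x h1 h3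
    rw [← h1]
    field_simp

/-! ### Band-limited functions and the negative Sobolev norm -/

lemma MeasureTheory.Integrable.exp_mul {θ : ℝ → ℝ} (h : Integrable θ unitMeasure) (ξ : ℝ) :
    Integrable (fun x : ℝ => Complex.exp (-(Complex.I * (ξ : ℂ) * (x : ℂ))) * (θ x : ℂ))
      unitMeasure := by
  refine h.ofReal.bdd_mul (c := 1)
    (by fun_prop : Continuous fun x : ℝ =>
      Complex.exp (-(Complex.I * (ξ : ℂ) * (x : ℂ)))).aestronglyMeasurable
    (.of_forall fun x => ?_)
  rw [Complex.norm_exp]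
  simp

lemma fourierTransform_congr_ae {θ θ' : ℝ → ℝ} (h : θ =ᵐ[unitMeasure] θ') :
    fourierTransform θ = fourierTransform θ' := by
  funext ξ
  rw [fourierTransform, fourierTransform]
  congr 1
  refine integral_congr_ae ?_
  filter_upwards [h] with x hx
  rw [hx]

lemma fourierTransform_add {θ θ' : ℝ → ℝ} (h : Integrable θ unitMeasure)
    (h' : Integrable θ' unitMeasure) (ξ : ℝ) :
    fourierTransform (θ + θ') ξ = fourierTransform θ ξ + fourierTransform θ' ξ := by
  rw [fourierTransform, fourierTransform, fourierTransform, ← mul_add,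
    ← integral_add (h.exp_mul ξ) (h'.exp_mul ξ)]
  congr 1
  exact integral_congr_ae (.of_forall fun x => by simp only [Pi.add_apply]; push_cast; ring)

lemma fourierTransform_const_smul (c : ℝ) (θ : ℝ → ℝ) (ξ : ℝ) :
    fourierTransform (c • θ) ξ = c • fourierTransform θ ξ := by
  rw [fourierTransform, fourierTransform, Complex.real_smul, mul_left_comm (c : ℂ),
    ← integral_const_mul (c : ℂ)]
  congr 1
  exact integral_congr_ae
    (.of_forall fun x => by simp only [Pi.smul_apply, smul_eq_mul]; push_cast; ring)

lemma continuous_fourierTransform {θ : ℝ → ℝ} (h : Integrable θ unitMeasure) :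
    Continuous (fourierTransform θ) := by
  refine continuous_const.mul (continuous_of_dominated (bound := fun x => ‖θ x‖)
    (fun ξ => (h.exp_mul ξ).aestronglyMeasurable) (fun ξ => .of_forall fun x => ?_) h.norm
    (.of_forall fun x => by fun_prop))
  rw [norm_mul, Complex.norm_exp]
  simp

lemma norm_fourierTransform_le {θ : ℝ → ℝ} (ξ : ℝ) :
    ‖fourierTransform θ ξ‖ ≤ (√(2 * Real.pi))⁻¹ * ∫ x, ‖θ x‖ ∂unitMeasure := by
  rw [fourierTransform, norm_mul, Complex.norm_real, Real.norm_of_nonneg (by positivity)]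
  refine mul_le_mul_of_nonneg_left ((norm_integral_le_integral_norm _).trans_eq ?_) (by positivity)
  refine integral_congr_ae (.of_forall fun x => ?_)
  simp only [norm_mul, Complex.norm_exp]
  simp

/-- Completeness of the trigonometric system, by Parseval's identity. -/
lemma ae_eq_zero_of_fourierTransform_eq_zero {θ : ℝ → ℝ} (hθ : MemLp θ 2 unitMeasure)
    (h : ∀ n : ℤ, fourierTransform θ (2 * Real.pi * n) = 0) : θ =ᵐ[unitMeasure] 0 := by
  have hL2 : MemLp (fun x => (θ x : ℂ)) 2 (volume.restrict (Ioc (0 : ℝ) 1)) := by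
    rw [← restrict_Ioo_eq_restrict_Ioc]
    exact hθ.ofReal
  have hc : ∀ n : ℤ, fourierCoeffOn zero_lt_one (fun x => (θ x : ℂ)) n = 0 := by
    intro n
    have h1 := h n
    rw [fourierTransform, mul_eq_zero, integral_unitMeasure] at h1
    have h2 := h1.resolve_left (by
      rw [Complex.ofReal_eq_zero]
      exact inv_ne_zero (Real.sqrt_ne_zero'.2 (by positivity)))
    rw [fourierCoeffOn_eq_integral]
    refine smul_eq_zero_of_right _ (Eq.trans ?_ h2)
    refine intervalIntegral.integral_congr fun x _ => ?_
    simp only [fourier_coe_apply, smul_eq_mul]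
    congr 2
    push_cast
    ring
  have key := tsum_sq_fourierCoeffOn zero_lt_one hL2
  simp only [hc, norm_zero, sub_zero, inv_one, one_smul, Complex.norm_real] at key
  rw [← integral_unitMeasure] at key
  simp only [ne_eq, OfNat.ofNat_ne_zero, not_false_eq_true, zero_pow, tsum_zero, Real.norm_eq_abs,
    sq_abs] at key
  have h0 := (integral_eq_zero_iff_of_nonneg (fun x => sq_nonneg (θ x)) hθ.integrable_sq).1 key.symm
  filter_upwards [h0] with x hx
  exact pow_eq_zero_iff two_ne_zero |>.1 hx

lemma memLp_weight_mul_fourierTransform {θ : ℝ → ℝ} (hθ : MemLp θ 2 unitMeasure) :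
    MemLp (fun ξ : ℝ => (1 + ξ ^ 2)⁻¹ • fourierTransform θ ξ) 2 volume := by
  have hw : MemLp (fun ξ : ℝ => (1 + ξ ^ 2)⁻¹) 2 volume := by
    have hc : Continuous fun ξ : ℝ => (1 + ξ ^ 2)⁻¹ :=
      Continuous.inv₀ (by fun_prop) fun ξ => by positivity
    rw [memLp_two_iff_integrable_sq hc.aestronglyMeasurable]
    refine integrable_inv_one_add_sq.mono' (hc.pow 2).aestronglyMeasurable
      (.of_forall fun ξ => ?_)
    have h1 : (1 + ξ ^ 2)⁻¹ ≤ 1 := inv_le_one_of_one_le₀ (by nlinarith [sq_nonneg ξ])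
    have h0 : 0 ≤ (1 + ξ ^ 2)⁻¹ := by positivity
    rw [Real.norm_of_nonneg (by positivity)]
    nlinarith
  have hF : MemLp (fourierTransform θ) ⊤ volume :=
    memLp_top_of_bound (continuous_fourierTransform hθ.integrable_two).aestronglyMeasurable _
      (.of_forall norm_fourierTransform_le)
  exact hF.smul (r := 2) hw

/-- The map `θ ↦ (1 + ξ²)⁻¹ 𝓕θ`, whose norm in `L²(ℝ)` is the `H⁻²` norm. -/
noncomputable def weightedFourier : Lp ℝ 2 unitMeasure →ₗ[ℝ] Lp ℂ 2 (volume : Measure ℝ) where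
  toFun p := MemLp.toLp (fun ξ : ℝ => (1 + ξ ^ 2)⁻¹ • fourierTransform p ξ)
    (memLp_weight_mul_fourierTransform (Lp.memLp p))
  map_add' p q := by
    rw [← MemLp.toLp_add, MemLp.toLp_eq_toLp_iff]
    refine .of_forall fun ξ => ?_
    rw [Pi.add_apply, ← smul_add, ← fourierTransform_add (Lp.memLp p).integrable_two
      (Lp.memLp q).integrable_two, fourierTransform_congr_ae (Lp.coeFn_add p q)]
  map_smul' c p := by
    rw [RingHom.id_apply, ← MemLp.toLp_const_smul, MemLp.toLp_eq_toLp_iff]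
    refine .of_forall fun ξ => ?_
    rw [Pi.smul_apply, smul_comm c, ← fourierTransform_const_smul,
      fourierTransform_congr_ae (Lp.coeFn_smul c p)]

lemma weightedFourier_ae_eq (p : Lp ℝ 2 unitMeasure) :
    weightedFourier p =ᵐ[volume] fun ξ : ℝ => (1 + ξ ^ 2)⁻¹ • fourierTransform p ξ :=
  (memLp_weight_mul_fourierTransform (Lp.memLp p)).coeFn_toLp

lemma norm_weightedFourier_sq (p : Lp ℝ 2 unitMeasure) :
    ‖weightedFourier p‖ ^ 2 = hNegTwoNorm p ^ 2 := by
  rw [hNegTwoNorm, Real.sq_sqrt (integral_nonneg fun ξ => sq_nonneg _),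
    ← inner_self_eq_norm_sq (𝕜 := ℂ), L2.inner_def, ← integral_re (L2.integrable_inner _ _)]
  refine integral_congr_ae ?_
  filter_upwards [weightedFourier_ae_eq p] with ξ hξ
  rw [inner_self_eq_norm_sq, hξ, norm_smul, Real.norm_of_nonneg (by positivity)]

lemma weightedFourier_injective : Function.Injective weightedFourier := by
  rw [injective_iff_map_eq_zero]
  intro p hp
  have h1 := weightedFourier_ae_eq p
  rw [hp] at h1
  have h2 : fourierTransform p =ᵐ[volume] fun _ => 0 := by
    filter_upwards [h1, Lp.coeFn_zero ℂ 2 (volume : Measure ℝ)] with ξ h1 h2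
    rw [h2, Pi.zero_apply, eq_comm, smul_eq_zero] at h1
    exact h1.resolve_left (inv_ne_zero (by positivity))
  have h3 : fourierTransform p = fun _ => 0 := Continuous.ae_eq_iff_eq volume
    (continuous_fourierTransform (Lp.memLp p).integrable_two) continuous_const |>.1 h2
  rw [Lp.eq_zero_iff_ae_eq_zero]
  exact ae_eq_zero_of_fourierTransform_eq_zero (Lp.memLp p) fun n => by rw [h3]

/-- The subspace of `L²(0,1)` of functions band-limited to `[-T,T]`. -/
def bandLimited (T : ℝ) : Submodule ℝ (Lp ℝ 2 unitMeasure) where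
  carrier := {p | IsBandLimited T p}
  zero_mem' n _ := by
    rw [fourierTransform_congr_ae (Lp.coeFn_zero ℝ 2 unitMeasure)]
    simp [fourierTransform]
  add_mem' {p q} hp hq n hn := by
    rw [fourierTransform_congr_ae (Lp.coeFn_add p q), fourierTransform_add
      (Lp.memLp p).integrable_two (Lp.memLp q).integrable_two, hp n hn, hq n hn, add_zero]
  smul_mem' c p hp n hn := by
    rw [fourierTransform_congr_ae (Lp.coeFn_smul c p), fourierTransform_const_smul, hp n hn,
      smul_zero]

/-- A band-limited function is determined by finitely many Fourier coefficients. -/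
instance finiteDimensional_bandLimited (T : ℝ) : FiniteDimensional ℝ (bandLimited T) := by
  let S : Finset ℤ := Finset.Icc (-⌈T⌉) ⌈T⌉
  let c : bandLimited T →ₗ[ℝ] (S → ℂ) :=
    { toFun := fun p n => fourierTransform (p : Lp ℝ 2 unitMeasure) (2 * Real.pi * (n : ℤ))
      map_add' := fun p q => by
        funext n
        rw [Submodule.coe_add, fourierTransform_congr_ae (Lp.coeFn_add _ _), fourierTransform_add
          (Lp.memLp _).integrable_two (Lp.memLp _).integrable_two, Pi.add_apply]
      map_smul' := fun a p => by
        funext n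
        rw [Submodule.coe_smul, fourierTransform_congr_ae (Lp.coeFn_smul _ _),
          fourierTransform_const_smul, Pi.smul_apply, RingHom.id_apply] }
  refine Module.Finite.of_injective c ?_
  rw [injective_iff_map_eq_zero]
  intro p hp
  rw [← Submodule.coe_eq_zero, Lp.eq_zero_iff_ae_eq_zero]
  refine ae_eq_zero_of_fourierTransform_eq_zero (Lp.memLp _) fun n => ?_
  by_cases hn : n ∈ S
  · exact congrFun hp ⟨n, hn⟩
  · refine p.2 n fun hT => hn ?_
    -- `|n| ≤ 2π|n| ≤ T`
    have hpi : 1 ≤ 2 * Real.pi := by linarith [Real.pi_gt_three]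
    have habs : |(n : ℝ)| ≤ T := by
      refine le_trans ?_ (abs_le.2 hT)
      rw [abs_mul, abs_of_pos (a := 2 * Real.pi) (by positivity)]
      exact le_mul_of_one_le_left (abs_nonneg _) hpi
    have hceil := habs.trans (Int.le_ceil T)
    rw [abs_le] at hceil
    rw [Finset.mem_Icc]
    exact ⟨by exact_mod_cast hceil.1, by exact_mod_cast hceil.2⟩

/-- On the finite-dimensional space of band-limited functions the norms of `L²` and of `H⁻²` are
equivalent. -/
lemma exists_hNegTwoNorm_equiv (T : ℝ) :
    ∃ a > 0, ∃ b > 0, ∀ θ : ℝ → ℝ, MemLp θ 2 unitMeasure → IsBandLimited T θ →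
      a * hNegTwoNorm θ ^ 2 ≤ ∫ x, θ x ^ 2 ∂unitMeasure ∧
      ∫ x, θ x ^ 2 ∂unitMeasure ≤ b * hNegTwoNorm θ ^ 2 := by
  let Φ : bandLimited T →ₗ[ℝ] Lp ℂ 2 (volume : Measure ℝ) := weightedFourier.domRestrict _
  have hΦ : LinearMap.ker Φ = ⊥ :=
    LinearMap.ker_eq_bot.2 (weightedFourier_injective.comp Subtype.val_injective)
  obtain ⟨K, hK0, hK⟩ := Φ.exists_antilipschitzWith hΦ
  set C : ℝ := ‖LinearMap.toContinuousLinearMap Φ‖ + 1 with hC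
  have hC0 : 0 < C := by positivity
  have hK0' : (0 : ℝ) < K := hK0
  refine ⟨(C ^ 2)⁻¹, by positivity, (K : ℝ) ^ 2, by positivity, fun θ hθ hb => ?_⟩
  have hae : hθ.toLp θ =ᵐ[unitMeasure] θ := hθ.coeFn_toLp
  have hF := fourierTransform_congr_ae hae
  let p : bandLimited T := ⟨hθ.toLp θ, fun n hn => by rw [hF]; exact hb n hn⟩
  have hN : ‖Φ p‖ ^ 2 = hNegTwoNorm θ ^ 2 := by
    refine (norm_weightedFourier_sq (hθ.toLp θ)).trans ?_
    rw [hNegTwoNorm, hNegTwoNorm, hF]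
  have hE : ‖p‖ ^ 2 = ∫ x, θ x ^ 2 ∂unitMeasure := by
    change ‖hθ.toLp θ‖ ^ 2 = _
    rw [← real_inner_self_eq_norm_sq, L2.inner_def]
    refine integral_congr_ae ?_
    filter_upwards [hae] with x hx
    rw [hx, RCLike.inner_apply, conj_trivial, sq]
  rw [← hN, ← hE]
  constructor
  · have h1 : ‖Φ p‖ ≤ C * ‖p‖ := (LinearMap.toContinuousLinearMap Φ).le_opNorm p |>.trans
      (mul_le_mul_of_nonneg_right (by rw [hC]; linarith) (norm_nonneg _))
    rw [inv_mul_le_iff₀ (by positivity), ← mul_pow]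
    exact pow_le_pow_left₀ (norm_nonneg _) h1 2
  · have h1 : ‖p‖ ≤ K * ‖Φ p‖ := by simpa using hK.le_mul_dist p 0
    rw [← mul_pow]
    exact pow_le_pow_left₀ (norm_nonneg _) h1 2

/-! ### The Hessian estimate -/

/-- Completing the square: `θ² - 2 r θ u + (κ + r²) u² ≥ κ (κ + r²)⁻¹ θ²`. -/
lemma mul_sq_le_quadratic {m M κ r θ u : ℝ} (hm : 0 < m) (hκ : m ^ 2 < κ) (hr : |r| ≤ M) :
    m ^ 2 / (m ^ 2 + M ^ 2) * θ ^ 2 ≤ θ ^ 2 - 2 * (r * θ * u) + (κ + r ^ 2) * u ^ 2 := by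
  have hm2 : 0 < m ^ 2 := by positivity
  have hκ0 : 0 < κ := hm2.trans hκ
  have hq : 0 < κ + r ^ 2 := by positivity
  have hrM : r ^ 2 ≤ M ^ 2 := sq_le_sq' (abs_le.1 hr).1 (abs_le.1 hr).2
  have h1 : m ^ 2 / (m ^ 2 + M ^ 2) ≤ κ / (κ + r ^ 2) := by
    rw [div_le_div_iff₀ (by positivity) hq]
    nlinarith [mul_le_mul hκ.le hrM (sq_nonneg r) hκ0.le]
  refine (mul_le_mul_of_nonneg_right h1 (sq_nonneg θ)).trans ?_
  rw [div_mul_eq_mul_div, div_le_iff₀ hq]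
  nlinarith [sq_nonneg ((κ + r ^ 2) * u - r * θ)]

/-- The quadratic form of `B⁻¹` lies between `0` and `(1 - m² / (m² + M²)) ‖θ‖²`. -/
lemma IsGreenSolution.integral_bounds {m M ε lam κ : ℝ} {r θ v p : ℝ → ℝ} (hm : 0 < m)
    (hκ : m ^ 2 < κ) (hr : MemLp r ⊤ unitMeasure) (hrM : ∀ᵐ x ∂unitMeasure, |r x| ≤ M)
    (hε : 0 ≤ ε) (hlam : 0 ≤ lam) (hq : MemLp (fun x => κ + r x ^ 2) ⊤ unitMeasure)
    (hθ : MemLp θ 2 unitMeasure)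
    (h : IsGreenSolution ε lam (fun x => κ + r x ^ 2) (fun x => r x * θ x) v p) :
    m ^ 2 / (m ^ 2 + M ^ 2) * ∫ x, θ x ^ 2 ∂unitMeasure ≤
        ∫ x, θ x * (θ x - r x * green v x) ∂unitMeasure ∧
      ∫ x, θ x * (θ x - r x * green v x) ∂unitMeasure ≤ ∫ x, θ x ^ 2 ∂unitMeasure := by
  have hu := h.memLp_left.green
  have hf : MemLp (fun x => r x * θ x) 2 unitMeasure := hθ.mul (r := 2) hr
  have hJ := h.integral_weight_le hε hlam hq
  have hJ0 : 0 ≤ ∫ x, (κ + r x ^ 2) * green v x ^ 2 ∂unitMeasure :=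
    integral_nonneg fun x => by
      have : 0 < κ := (by positivity : (0 : ℝ) < m ^ 2).trans hκ
      positivity
  have i1 : Integrable (fun x => θ x ^ 2) unitMeasure := hθ.integrable_sq
  have i2 : Integrable (fun x => r x * θ x * green v x) unitMeasure := hf.integrable_mul hu
  have i3 : Integrable (fun x => (κ + r x ^ 2) * green v x ^ 2) unitMeasure := by
    have : MemLp (fun x => (κ + r x ^ 2) * green v x) 2 unitMeasure := hu.mul (r := 2) hq
    exact (this.integrable_mul hu).congr (.of_forall fun x => by simp only [Pi.mul_apply]; ring)
  have e1 : ∫ x, θ x * (θ x - r x * green v x) ∂unitMeasure =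
      ∫ x, θ x ^ 2 ∂unitMeasure - ∫ x, r x * θ x * green v x ∂unitMeasure := by
    rw [← integral_sub i1 i2]
    exact integral_congr_ae (.of_forall fun x => by simp only; ring)
  have i4 : Integrable (fun x => θ x ^ 2 - 2 * (r x * θ x * green v x)) unitMeasure :=
    i1.sub (i2.const_mul 2)
  have hsq : m ^ 2 / (m ^ 2 + M ^ 2) * ∫ x, θ x ^ 2 ∂unitMeasure ≤
      ∫ x, θ x ^ 2 ∂unitMeasure - 2 * ∫ x, r x * θ x * green v x ∂unitMeasure +
        ∫ x, (κ + r x ^ 2) * green v x ^ 2 ∂unitMeasure := by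
    rw [← integral_const_mul, ← integral_const_mul, ← integral_sub i1 (i2.const_mul 2),
      ← integral_add i4 i3]
    refine integral_mono_ae (i1.const_mul _) (i4.add i3) ?_
    filter_upwards [hrM] with x hx
    exact mul_sq_le_quadratic hm hκ hx
  rw [e1]
  constructor <;> linarith

theorem theorem1 :
    ∀ T : ℝ, 0 < T →
    ∃ lam₀ : ℝ, 0 < lam₀ ∧ ∃ ε₀ : ℝ, 0 < ε₀ ∧
    ∀ K : ℝ, ∃ κ₀ : ℝ, K < κ₀ ∧
    ∀ (m M : ℝ) (ρ ρx : ℝ → ℝ), IsWeakDeriv 1 ρ ρx → MemSobolev 2 ρx → 0 < m →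
      (∀ᵐ x ∂unitMeasure, m ≤ |ρx x| ∧ |ρx x| ≤ M) →
    ∃ C₁ : ℝ, 0 < C₁ ∧ ∃ C₂ : ℝ, 0 < C₂ ∧
    ∀ κ lam ε : ℝ, m ^ 2 < κ → κ < κ₀ → 0 ≤ lam → lam ≤ lam₀ → 0 < ε → ε ≤ ε₀ →
    ∀ θ : ℝ → ℝ, MemLp θ 2 unitMeasure → IsBandLimited T θ →
      ∃ w : ℝ → ℝ, IsBPreimage ε lam κ ρx θ w ∧
        (∀ w' : ℝ → ℝ, IsBPreimage ε lam κ ρx θ w' → w' =ᵐ[unitMeasure] w) ∧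
        (¬ θ =ᵐ[unitMeasure] (fun _ => 0) → 0 < C₁ * hNegTwoNorm θ ^ 2) ∧
        C₁ * hNegTwoNorm θ ^ 2 ≤ ∫ x, θ x * (θ x - w x) ∂unitMeasure ∧
        ∫ x, θ x * (θ x - w x) ∂unitMeasure ≤ C₂ * hNegTwoNorm θ ^ 2 := by
  intro T _
  obtain ⟨a, ha, b, hb, hab⟩ := exists_hNegTwoNorm_equiv T
  -- the estimate holds for all parameters, so the thresholds are arbitrary
  refine ⟨1, one_pos, 1, one_pos, fun K => ⟨K + 1, by linarith, fun m M ρ r _ hS hm hmM => ?_⟩⟩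
  have hr0 : ∀ᵐ x ∂unitMeasure, r x ≠ 0 := hmM.mono fun x hx => abs_pos.1 (hm.trans_le hx.1)
  have hrM : ∀ᵐ x ∂unitMeasure, |r x| ≤ M := hmM.mono fun x hx => hx.2
  have hrm : AEStronglyMeasurable r unitMeasure := by
    obtain ⟨g, hg, hd⟩ := hS 0 (by norm_num)
    exact hg.aestronglyMeasurable.congr hd.ae_eq_of_zero
  have hr : MemLp r ⊤ unitMeasure := memLp_top_of_bound hrm M hrM
  have hc : 0 < m ^ 2 / (m ^ 2 + M ^ 2) := by positivity
  refine ⟨m ^ 2 / (m ^ 2 + M ^ 2) * a, by positivity, b, hb, ?_⟩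
  intro κ lam ε hκ _ hlam _ hε _ θ hθ hband
  have hκ0 : 0 < κ := (by positivity : (0 : ℝ) < m ^ 2).trans hκ
  have hq : MemLp (fun x => κ + r x ^ 2) ⊤ unitMeasure := by
    refine memLp_top_of_bound (by fun_prop) (κ + M ^ 2) (hrM.mono fun x hx => ?_)
    rw [Real.norm_of_nonneg (by positivity)]
    gcongr κ + ?_
    exact sq_le_sq' (abs_le.1 hx).1 (abs_le.1 hx).2
  have hq0 : ∀ᵐ x ∂unitMeasure, 0 ≤ κ + r x ^ 2 := .of_forall fun x => by positivity
  obtain ⟨v, p, hvp⟩ := exists_isGreenSolution hε hlam hq hq0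
    (hθ.mul (r := 2) hr : MemLp (fun x => r x * θ x) 2 unitMeasure)
  obtain ⟨hlow, hup⟩ := hvp.integral_bounds hm hκ hr hrM hε.le hlam hq hθ
  obtain ⟨hN1, hN2⟩ := hab θ hθ hband
  refine ⟨fun x => r x * green v x, hvp.isBPreimage hr hr0, fun w' hw' => ?_, fun hne => ?_, ?_,
    hup.trans hN2⟩
  · obtain ⟨v', p', h', hw⟩ := hw'.exists_isGreenSolution hr0
    have hv := h'.unique hvp hε hlam hq hq0
    filter_upwards [hw, ae_unitMeasure_of_forall_Icc fun x hx => green_congr_ae hv hx] with x h1 h2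
    rw [h1, h2]
  · have hpos : 0 < ∫ x, θ x ^ 2 ∂unitMeasure := by
      refine lt_of_le_of_ne (integral_nonneg fun x => sq_nonneg _) fun h0 => hne ?_
      have h1 := (integral_eq_zero_iff_of_nonneg (fun x => sq_nonneg (θ x)) hθ.integrable_sq).1
        h0.symm
      filter_upwards [h1] with x hx
      exact pow_eq_zero_iff two_ne_zero |>.1 hx
    have := pos_of_mul_pos_right (hpos.trans_le hN2) hb.le
    positivity
  · rw [mul_assoc]
    exact (mul_le_mul_of_nonneg_left hN1 hc.le).trans hlow
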